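/- All graphs are finite and simple and have no isolated vertices, i.e. they are given by their edge sets; $V(G)$ and $E(G)$ denote the vertex and edge set of $G$. A graph is $(2,3)$-sparse if every set $V'$ of at least two vertices spans at most $2|V'|-3$ edges. A rigidity circuit is a graph whose edge set is a circuit of the $(2,3)$-sparsity matroid, i.e. a graph that is not $(2,3)$-sparse while all its proper subgraphs without isolated vertices are. If $A\neq B$ are two graphs with a common edge $e$, their combinatorial resultant on $e$, denoted $\mathrm{CRes}(A,B,e)$, is the graph with vertex set $V(A)\cup V(B)$ and edge set $(E(A)\cup E(B))\setminus\{e\}$. A resultant tree for a rigidity circuit $C$ with $n$ vertices is a finite rooted binary tree (every internal node has exactly two children) whose nodes are labelled by graphs, with $C$ at the root (level $0$), such that: (a) all nodes are rigidity circuits; (b) the circuits on level $l$ have at most $n-l$ vertices; (c) every internal node $C_i$ with children $C_j$, $C_k$ satisfies $C_i=\mathrm{CRes}(C_j,C_k,e)$ for some common edge $e$ of $C_j$ and $C_k$; (d) all leaves are complete graphs on $4$ vertices. **Theorem.** Every rigidity circuit can be obtained inductively, starting from complete graphs $K_4$ on four vertices, by applying combinatorial resultant operations, all intermediate graphs being rigidity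 circuits. Moreover, every rigidity circuit $C$ has a resultant tree. -/

import Mathlib

/-! Graphs are given by their edge sets: a `SimpleGraph V` is a set of edges of the complete graph
on `V`, and its vertex set is its vertex span `G.support` (the endpoints of its edges). -/

/-- `G` is `(2,3)`-sparse: every set `S` of at least two vertices spans at most
`2 * |S| - 3` edges of `G`. -/
def IsSparse {V : Type*} (G : SimpleGraph V) : Prop :=
  ∀ S : Finset V, 2 ≤ S.card →
    {e : Sym2 V | e ∈ G.edgeSet ∧ ∀ v ∈ e, v ∈ S}.ncard + 3 ≤ 2 * S.card

/-- A rigidity circuit: a minimal dependent edge set of the `(2,3)`-sparsity matroid, whose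
independent sets are the edge sets of the sparse graphs. -/
def IsRigidityCircuit {V : Type*} (C : SimpleGraph V) : Prop :=
  Minimal (fun G : SimpleGraph V => ¬ IsSparse G) C

/-- `C` is the combinatorial resultant of the distinct graphs `A` and `B` on the common edge `e`:
its vertex set is the union of the two vertex sets, and its edge set is the union of the two
edge sets without `e`. -/
structure IsCombRes {V : Type*} (A B : SimpleGraph V) (e : Sym2 V) (C : SimpleGraph V) :
    Prop where
  ne : A ≠ B
  mem_left : e ∈ A.edgeSet
  mem_right : e ∈ B.edgeSet
  verts_eq : C.support = A.support ∪ B.support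
  edges_eq : C.edgeSet = (A.edgeSet ∪ B.edgeSet) \ {e}

/-- `G` is a complete graph on four vertices. -/
def IsK4 {V : Type*} (G : SimpleGraph V) : Prop :=
  ∃ S : Finset V, S.card = 4 ∧ ∀ u v : V, G.Adj u v ↔ u ∈ S ∧ v ∈ S ∧ u ≠ v

/-- Circuits obtained inductively from `K₄` graphs by combinatorial resultant operations, all
intermediate graphs being circuits. -/
inductive ObtainedFromK4 {V : Type*} : SimpleGraph V → Prop where
  | base (G : SimpleGraph V) (hG : IsK4 G) : ObtainedFromK4 G
  | step (A B C : SimpleGraph V) (e : Sym2 V) (hA : ObtainedFromK4 A) (hB : ObtainedFromK4 B)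
      (hres : IsCombRes A B e C) (hC : IsRigidityCircuit C) : ObtainedFromK4 C

/-- Rooted binary trees whose nodes are labelled by graphs; every internal node has exactly two
children. -/
inductive GraphTree (V : Type*) where
  | leaf (G : SimpleGraph V) : GraphTree V
  | node (G : SimpleGraph V) (L R : GraphTree V) : GraphTree V

namespace GraphTree

/-- The label of the root. -/
def root {V : Type*} : GraphTree V → SimpleGraph V
  | leaf G => G
  | node G _ _ => G

/-- `T.HasNodeAt l H`: the tree `T` has a node labelled `H` on level `l` (the root is on
level `0`). -/
def HasNodeAt {V : Type*} : GraphTree V → ℕ → SimpleGraph V → Prop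
  | leaf G, 0, H => H = G
  | leaf _, _ + 1, _ => False
  | node G _ _, 0, H => H = G
  | node _ L R, l + 1, H => L.HasNodeAt l H ∨ R.HasNodeAt l H

/-- Every internal node is a combinatorial resultant of its two children. -/
def NodesAreResultants {V : Type*} : GraphTree V → Prop
  | leaf _ => True
  | node G L R =>
      (∃ e : Sym2 V, IsCombRes L.root R.root e G) ∧ L.NodesAreResultants ∧ R.NodesAreResultants

/-- Every leaf is a complete graph on four vertices. -/
def LeavesAreK4 {V : Type*} : GraphTree V → Prop
  | leaf G => IsK4 G
  | node _ L R => L.LeavesAreK4 ∧ R.LeavesAreK4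

end GraphTree

/-- `T` is a resultant tree for `C`, where `C` has `n = C.support.ncard` vertices. -/
structure IsResultantTree {V : Type*} (C : SimpleGraph V) (T : GraphTree V) : Prop where
  root_eq : T.root = C
  nodes_circuit : ∀ (l : ℕ) (G : SimpleGraph V), T.HasNodeAt l G → IsRigidityCircuit G
  level_bound : ∀ (l : ℕ) (G : SimpleGraph V), T.HasNodeAt l G →
    G.support.ncard + l ≤ C.support.ncard
  nodes_resultant : T.NodesAreResultants
  leaves_K4 : T.LeavesAreK4

/-! Induct on the number of vertices. A circuit on n vertices has 2n-2 edges and minimum degree at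
least 3, so at least four vertices have degree 3. If four of these are pairwise adjacent, they span
a `K₄`, which is dependent and hence is all of C. Otherwise take nonadjacent a, b of degree 3. C-a-b
has one edge too few to be tight, so some new edge xy keeps it sparse (`exists_pair_of_not_adj`).
But C-a+xy and C-b+xy are dependent by counting, and contain circuits A, B through xy. They differ,
since a common one would lie in the sparse C-a-b+xy. By circuit elimination (A ∪ B) \ xy is
dependent; it lies in C, so minimality makes it C. A misses a and B misses b, so each level of the
tree loses a vertex. -/

namespace SimpleGraph

/-! ### Edge counts and tight sets -/

variable {V : Type*}

/-- The edges of `G` spanned by the vertex set `S`. -/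
abbrev spannedEdges (G : SimpleGraph V) (S : Finset V) : Set (Sym2 V) :=
  {e : Sym2 V | e ∈ G.edgeSet ∧ ∀ v ∈ e, v ∈ S}

lemma spannedEdges_eq_edgeSet {G : SimpleGraph V} {S : Finset V} (h : G.support ⊆ S) :
    G.spannedEdges S = G.edgeSet := by
  ext e
  refine ⟨fun he => he.1, fun he => ⟨he, fun v hv => h ?_⟩⟩
  obtain ⟨w, rfl⟩ := hv
  exact ⟨w, he⟩

lemma ncard_spannedEdges_add_le [Finite V] [DecidableEq V] (A B : SimpleGraph V)
    (S T : Finset V) :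
    (A.spannedEdges S).ncard + (B.spannedEdges T).ncard ≤
      ((A ⊔ B).spannedEdges (S ∪ T)).ncard + ((A ⊓ B).spannedEdges (S ∩ T)).ncard := by
  rw [← Set.ncard_union_add_ncard_inter _ _ (Set.toFinite _) (Set.toFinite _)]
  refine Nat.add_le_add (Set.ncard_le_ncard ?_ (Set.toFinite _))
    (Set.ncard_le_ncard ?_ (Set.toFinite _))
  · rintro e (⟨h1, h2⟩ | ⟨h1, h2⟩)
    · exact ⟨by rw [edgeSet_sup]; exact Or.inl h1,
        fun v hv => Finset.mem_union_left _ (h2 v hv)⟩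
    · exact ⟨by rw [edgeSet_sup]; exact Or.inr h1,
        fun v hv => Finset.mem_union_right _ (h2 v hv)⟩
  · rintro e ⟨⟨h1, h2⟩, h3, h4⟩
    exact ⟨by rw [edgeSet_inf]; exact ⟨h1, h3⟩,
      fun v hv => Finset.mem_inter.2 ⟨h2 v hv, h4 v hv⟩⟩

lemma not_isSparse_iff {G : SimpleGraph V} :
    ¬ IsSparse G ↔ ∃ S : Finset V, 2 ≤ S.card ∧ 2 * S.card ≤ (G.spannedEdges S).ncard + 2 := by
  simp only [IsSparse, not_forall, exists_prop, not_le]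
  exact exists_congr fun S => and_congr_right fun _ => by
    rw [spannedEdges]; omega

lemma _root_.IsSparse.mono [Finite V] {G H : SimpleGraph V} (hG : IsSparse G) (h : H ≤ G) :
    IsSparse H := fun S hS =>
  (Nat.add_le_add_right (Set.ncard_le_ncard (t := G.spannedEdges S)
    (fun _ he => ⟨edgeSet_mono h he.1, he.2⟩) (Set.toFinite _)) 3).trans (hG S hS)

lemma _root_.IsSparse.ncard_edgeSet_add_three_le {G : SimpleGraph V} (hG : IsSparse G)
    {S : Finset V} (hS : 2 ≤ S.card) (h : G.support ⊆ S) :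
    G.edgeSet.ncard + 3 ≤ 2 * S.card := by
  have := hG S hS
  rwa [← spannedEdges_eq_edgeSet h]

lemma exists_isRigidityCircuit_le [Finite V] {G : SimpleGraph V} (hG : ¬ IsSparse G) :
    ∃ A ≤ G, IsRigidityCircuit A :=
  (Set.toFinite {H : SimpleGraph V | ¬ IsSparse H}).exists_le_minimal hG

/-- A set of vertices is tight if it spans at least `2 * |T| - 3` edges. -/
def IsTightSet (G : SimpleGraph V) (T : Finset V) : Prop :=
  2 * T.card ≤ (G.spannedEdges T).ncard + 3

/-- Spanned-edge counts are supermodular, and two common vertices allow sparsity to bound the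
intersection. -/
lemma IsTightSet.union [Finite V] [DecidableEq V] {G : SimpleGraph V} (hG : IsSparse G)
    {S T : Finset V} (hS : G.IsTightSet S) (hT : G.IsTightSet T) (h : 2 ≤ (S ∩ T).card) :
    G.IsTightSet (S ∪ T) := by
  have h1 := ncard_spannedEdges_add_le G G S T
  rw [sup_idem, inf_idem] at h1
  have h2 := hG _ h
  have h3 := Finset.card_union_add_card_inter S T
  unfold IsTightSet at *
  simp only [spannedEdges] at *
  omega

lemma disjoint_spannedEdges [DecidableEq V] (G : SimpleGraph V) {S T : Finset V}
    (h : (S ∩ T).card ≤ 1) : Disjoint (G.spannedEdges S) (G.spannedEdges T) := by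
  rw [Set.disjoint_left]
  rintro e ⟨he, hS⟩ ⟨-, hT⟩
  induction e with
  | _ u v =>
    exact G.ne_of_adj he (Finset.card_le_one.1 h u
      (Finset.mem_inter.2 ⟨hS u (by simp), hT u (by simp)⟩) v
      (Finset.mem_inter.2 ⟨hS v (by simp), hT v (by simp)⟩))

/-- Three tight sets that pairwise share a single vertex, the shared vertices not being all
equal, have a tight union. -/
lemma IsTightSet.union_union [Finite V] [DecidableEq V] {G : SimpleGraph V} {S T U : Finset V}
    (hS : G.IsTightSet S) (hT : G.IsTightSet T) (hU : G.IsTightSet U)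
    (hST : (S ∩ T).card = 1) (hSU : (S ∩ U).card ≤ 1) (hTU : (T ∩ U).card ≤ 1)
    (h : 2 ≤ ((S ∪ T) ∩ U).card) : G.IsTightSet (S ∪ T ∪ U) := by
  have h1 := Set.ncard_union_eq (G.disjoint_spannedEdges hST.le) (Set.toFinite _) (Set.toFinite _)
  have h2 := Set.ncard_union_eq (Set.disjoint_union_left.2
    ⟨G.disjoint_spannedEdges hSU, G.disjoint_spannedEdges hTU⟩) (Set.toFinite _) (Set.toFinite _)
  have h3 : (G.spannedEdges S ∪ G.spannedEdges T ∪ G.spannedEdges U).ncard ≤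
      (G.spannedEdges (S ∪ T ∪ U)).ncard := by
    refine Set.ncard_le_ncard ?_ (Set.toFinite _)
    rintro e ((⟨he, hv⟩ | ⟨he, hv⟩) | ⟨he, hv⟩) <;>
      exact ⟨he, fun v hve => by simp [hv v hve]⟩
  -- The disjoint edge sets lose 3 · 3 against twice the sum of the sizes; overlaps of 1 and at
  -- least 2 vertices give back 6.
  have h6 := Finset.card_union_add_card_inter S T
  have h7 := Finset.card_union_add_card_inter (S ∪ T) U
  unfold IsTightSet at *
  omega

/-- A sparse graph with fewer than `2 * |S| - 3` edges leaves some pair of vertices of `S`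
outside of all tight sets. -/
lemma exists_pair_forall_not_isTightSet [Finite V] {G : SimpleGraph V} (hG : IsSparse G)
    {S : Finset V} (hS : 2 ≤ S.card) (h : G.edgeSet.ncard + 3 < 2 * S.card) :
    ∃ x ∈ S, ∃ y ∈ S, x ≠ y ∧ ∀ T : Finset V, x ∈ T → y ∈ T → ¬ G.IsTightSet T := by
  classical
  by_contra! hcon
  obtain ⟨p, hp, q, hq, hpq⟩ := Finset.one_lt_card.1 hS
  obtain ⟨T₀, hp₀, hq₀, hT₀⟩ := hcon p hp q hq hpq
  -- A maximal tight set T meeting S twice: containing S would force too many edges, and missing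
  -- some w of S will let T be enlarged.
  obtain ⟨T, hT⟩ := (Set.toFinite {T : Finset V | G.IsTightSet T ∧ 2 ≤ (T ∩ S).card}).exists_maximal
    ⟨T₀, hT₀, Finset.one_lt_card.2 ⟨p, by simp [*], q, by simp [*], hpq⟩⟩
  have hmax : ∀ U : Finset V, T ⊆ U → G.IsTightSet U → U ⊆ T := fun U hTU hU =>
    hT.le_of_ge ⟨hU, hT.prop.2.trans (Finset.card_le_card (Finset.inter_subset_inter_right hTU))⟩
      hTU
  by_cases hST : S ⊆ T
  · have h1 := Finset.card_le_card hST
    have h2 : (G.spannedEdges T).ncard ≤ G.edgeSet.ncard :=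
      Set.ncard_le_ncard (fun _ he => he.1) (Set.toFinite _)
    have h3 : 2 * T.card ≤ _ := hT.prop.1
    omega
  obtain ⟨w, hw, hwT⟩ := Finset.not_subset.1 hST
  have hone : ∀ U : Finset V, w ∈ U → G.IsTightSet U → (U ∩ T).card ≤ 1 := by
    intro U hwU hU
    by_contra! hlt
    exact hwT (hmax _ Finset.subset_union_right (hU.union hG hT.prop.1 hlt)
      (Finset.mem_union_left _ hwU))
  obtain ⟨x, hx, y, hy, hxy⟩ := Finset.one_lt_card.1 hT.prop.2
  rw [Finset.mem_inter] at hx hy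
  obtain ⟨X, hwX, hxX, hX⟩ := hcon w hw x hx.2 (by rintro rfl; exact hwT hx.1)
  obtain ⟨Y, hwY, hyY, hY⟩ := hcon w hw y hy.2 (by rintro rfl; exact hwT hy.1)
  have hXYT : 2 ≤ ((X ∪ Y) ∩ T).card :=
    Finset.one_lt_card.2 ⟨x, by simp [*], y, by simp [*], hxy⟩
  -- Otherwise X ∪ Y is a tight set through w meeting T in both x and y.
  have hXY : (X ∩ Y).card ≤ 1 := by
    by_contra! hlt
    have := hone _ (Finset.mem_union_left _ hwX) (hX.union hG hY hlt)
    omega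
  have hpos : 1 ≤ (X ∩ Y).card := Finset.card_pos.2 ⟨w, by simp [*]⟩
  have := hX.union_union hY hT.prop.1 (le_antisymm hXY hpos) (hone X hwX hX) (hone Y hwY hY) hXYT
  exact hwT (hmax _ Finset.subset_union_right this (by simp [*]))

/-- A set containing both ends is not tight, so it has room for one more edge. -/
lemma isSparse_sup_edge [Finite V] {G : SimpleGraph V} (hG : IsSparse G) {x y : V}
    (h : ∀ T : Finset V, x ∈ T → y ∈ T → ¬ G.IsTightSet T) : IsSparse (G ⊔ edge x y) := by
  intro S hS
  have h1 := hG S hS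
  by_cases hxy : x ∈ S ∧ y ∈ S
  · have h2 := h S hxy.1 hxy.2
    have h3 : ((G ⊔ edge x y).spannedEdges S).ncard ≤ (insert s(x, y) (G.spannedEdges S)).ncard := by
      refine Set.ncard_le_ncard ?_ (Set.toFinite _)
      rintro e ⟨he, hv⟩
      rw [edgeSet_sup] at he
      rcases he with he | he
      · exact Or.inr ⟨he, hv⟩
      · exact Or.inl (edgeSet_edge_subset he)
    have h4 := Set.ncard_insert_le s(x, y) (G.spannedEdges S)
    unfold IsTightSet at h2
    simp only [spannedEdges] at *
    omega
  · have h3 : (G ⊔ edge x y).spannedEdges S ⊆ G.spannedEdges S := by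
      rintro e ⟨he, hv⟩
      rw [edgeSet_sup] at he
      rcases he with he | he
      · exact ⟨he, hv⟩
      · obtain rfl : e = s(x, y) := edgeSet_edge_subset he
        exact absurd ⟨hv x (by simp), hv y (by simp)⟩ hxy
    have h4 := Set.ncard_le_ncard h3 (Set.toFinite _)
    simp only [spannedEdges] at *
    omega

/-- The complete graph on the vertex set `S`. -/
def completeOn (S : Finset V) : SimpleGraph V where
  Adj u v := u ∈ S ∧ v ∈ S ∧ u ≠ v
  symm := ⟨fun _ _ h => ⟨h.2.1, h.1, h.2.2.symm⟩⟩
  loopless := ⟨fun _ h => h.2.2 rfl⟩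

lemma ncard_edgeSet_completeOn (S : Finset V) :
    (completeOn S).edgeSet.ncard = S.card.choose 2 := by
  classical
  rw [← Sym2.card_image_offDiag, ← Set.ncard_coe_finset]
  congr 1
  ext e
  induction e with
  | _ u v =>
    simp only [mem_edgeSet, completeOn, Finset.coe_image, Set.mem_image]
    constructor
    · rintro ⟨h1, h2, h3⟩
      exact ⟨(u, v), by simp [*], rfl⟩
    · rintro ⟨⟨a, b⟩, hab, heq⟩
      simp only [Finset.coe_offDiag, Set.mem_offDiag, Finset.mem_coe] at hab
      rcases Sym2.eq_iff.1 heq with ⟨rfl, rfl⟩ | ⟨rfl, rfl⟩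
      · exact hab
      · exact ⟨hab.2.1, hab.1, hab.2.2.symm⟩

end SimpleGraph

/-! ### Structure of rigidity circuits -/

open SimpleGraph

namespace IsRigidityCircuit

variable {V : Type*} {C : SimpleGraph V}

lemma isSparse_of_lt (hC : IsRigidityCircuit C) {H : SimpleGraph V} (h : H < C) : IsSparse H := by
  by_contra hH
  exact hC.not_prop_of_lt h hH

lemma eq_of_le (hC : IsRigidityCircuit C) {H : SimpleGraph V} (hH : ¬ IsSparse H) (h : H ≤ C) :
    H = C :=
  Minimal.eq_of_le hC hH h

lemma deleteIncidenceSet_lt (C : SimpleGraph V) {w : V} (hw : w ∈ C.support) :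
    C.deleteIncidenceSet w < C := by
  refine lt_of_le_of_ne (deleteIncidenceSet_le C w) fun h => ?_
  obtain ⟨u, hu⟩ := hw
  rw [← h] at hu
  exact (deleteIncidenceSet_adj.1 hu).2.1 rfl

/-- A set violating sparsity carries all of C by minimality. Deleting one edge restores sparsity,
which bounds the edge count from above; the same bound on S minus a vertex shows that no vertex of S
is isolated. -/
lemma exists_support_eq [Finite V] (hC : IsRigidityCircuit C) :
    ∃ S : Finset V, C.support = S ∧ 4 ≤ S.card ∧ C.edgeSet.ncard + 2 = 2 * S.card := by
  classical
  obtain ⟨S, hS, hcard⟩ := not_isSparse_iff.1 hC.prop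
  let H : SimpleGraph V :=
    { Adj := fun u v => C.Adj u v ∧ u ∈ S ∧ v ∈ S
      symm := ⟨fun u v h => ⟨h.1.symm, h.2.2, h.2.1⟩⟩
      loopless := ⟨fun u h => C.irrefl h.1⟩ }
  have hHC : H = C := by
    refine hC.eq_of_le (not_isSparse_iff.2 ⟨S, hS, hcard.trans ?_⟩) fun u v h => h.1
    refine Nat.add_le_add_right (Set.ncard_le_ncard ?_ (Set.toFinite _)) 2
    rintro e ⟨he, hv⟩
    refine ⟨?_, hv⟩
    induction e with
    | _ u v => exact ⟨he, hv u (by simp), hv v (by simp)⟩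
  have hsub : C.support ⊆ S := by
    rintro u ⟨v, huv⟩
    rw [← hHC] at huv
    exact huv.2.1
  rw [spannedEdges_eq_edgeSet hsub] at hcard
  have hup : ∀ T : Finset V, 2 ≤ T.card → C.support ⊆ T → C.edgeSet.ncard + 2 ≤ 2 * T.card := by
    intro T hT hCT
    obtain ⟨e, he⟩ : C.edgeSet.Nonempty := by
      rw [← Set.ncard_pos (Set.toFinite _)]
      omega
    have hlt : C.deleteEdges {e} < C := by
      refine lt_of_le_of_ne (deleteEdges_le _) fun h => ?_
      rw [← h, edgeSet_deleteEdges] at he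
      exact he.2 rfl
    have h1 := (hC.isSparse_of_lt hlt).ncard_edgeSet_add_three_le hT
      ((support_mono hlt.le).trans hCT)
    rw [edgeSet_deleteEdges] at h1
    have := Set.ncard_sdiff_singleton_add_one he (Set.toFinite _)
    omega
  have h2 := hup S hS hsub
  have hfour : 4 ≤ S.card := by
    have h3 : C.edgeSet.ncard ≤ S.card.choose 2 := by
      rw [← ncard_edgeSet_completeOn]
      exact Set.ncard_le_ncard (edgeSet_mono fun u v huv =>
        ⟨hsub ⟨v, huv⟩, hsub ⟨u, huv.symm⟩, huv.ne⟩) (Set.toFinite _)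
    by_contra! h4
    obtain h | h : S.card = 2 ∨ S.card = 3 := by omega
    all_goals
      rw [h] at h3 hcard
      simp only [Nat.choose] at h3
      omega
  refine ⟨S, hsub.antisymm fun w hw => ?_, hfour, by omega⟩
  by_contra hwC
  have hcard := Finset.card_erase_of_mem (Finset.mem_coe.1 hw)
  have := hup (S.erase w) (by omega) fun v hv => by
    simp only [Finset.coe_erase, Set.mem_sdiff, Set.mem_singleton_iff]
    exact ⟨hsub hv, by rintro rfl; exact hwC hv⟩
  omega

lemma ncard_edgeSet_deleteIncidenceSet [Finite V] (G : SimpleGraph V) (w : V) :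
    (G.deleteIncidenceSet w).edgeSet.ncard + (G.neighborSet w).ncard = G.edgeSet.ncard := by
  classical
  have := Fintype.ofFinite V
  have h1 : (G.neighborSet w).ncard = (G.incidenceSet w).ncard :=
    Set.ncard_congr' (G.incidenceSetEquivNeighborSet w).symm
  rw [h1, edgeSet_deleteIncidenceSet]
  exact Set.ncard_sdiff_add_ncard_of_subset (G.incidenceSet_subset w) (Set.toFinite _)

/-- Deleting w leaves a sparse graph, with at most 2(n-1)-3 of the 2n-2 edges. -/
lemma three_le_ncard_neighborSet [Finite V] (hC : IsRigidityCircuit C) {w : V}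
    (hw : w ∈ C.support) : 3 ≤ (C.neighborSet w).ncard := by
  classical
  obtain ⟨S, hS, h4, hcard⟩ := hC.exists_support_eq
  have hwS : w ∈ S := by rw [← Finset.mem_coe, ← hS]; exact hw
  have h1 := Finset.card_erase_of_mem hwS
  have h2 := (hC.isSparse_of_lt (deleteIncidenceSet_lt C hw)).ncard_edgeSet_add_three_le
    (S := S.erase w) (by omega) ((support_deleteIncidenceSet_subset C w).trans (by simp [hS]))
  have h3 := ncard_edgeSet_deleteIncidenceSet C w
  omega

/-- A circuit has at least four vertices of degree three. -/
lemma exists_four_degree_three [Finite V] (hC : IsRigidityCircuit C) :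
    ∃ T : Finset V, T.card = 4 ∧ ∀ v ∈ T, (C.neighborSet v).ncard = 3 := by
  classical
  have := Fintype.ofFinite V
  obtain ⟨S, hS, h4, hcard⟩ := hC.exists_support_eq
  have hmem : ∀ v, v ∈ S ↔ v ∈ C.support := fun v => by rw [hS, Finset.mem_coe]
  have hdeg : ∀ v, C.degree v = (C.neighborSet v).ncard := fun v => by
    rw [← Nat.card_coe_set_eq, Nat.card_eq_fintype_card, card_neighborSet_eq_degree]
  have hsum := C.sum_degrees_eq_twice_card_edges
  rw [← coe_edgeFinset, Set.ncard_coe_finset] at hcard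
  rw [← Finset.sum_subset (Finset.subset_univ S) (fun v _ hv => by
    rw [degree_eq_zero_iff_notMem_support]; rwa [← hmem])] at hsum
  -- The degrees sum to 4n-4, so the degree-3 indicators must supply the missing 4.
  have hle : ∑ v ∈ S, 4 ≤ ∑ v ∈ S, (C.degree v + if C.degree v = 3 then 1 else 0) := by
    refine Finset.sum_le_sum fun v hv => ?_
    have := hC.three_le_ncard_neighborSet ((hmem v).1 hv)
    rw [← hdeg] at this
    split_ifs <;> omega
  rw [Finset.sum_add_distrib, hsum, ← Finset.card_filter, Finset.sum_const, smul_eq_mul] at hle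
  obtain ⟨T, hT, hT4⟩ := Finset.exists_subset_card_eq
    (show 4 ≤ (S.filter fun v => C.degree v = 3).card by omega)
  exact ⟨T, hT4, fun v hv => by rw [← hdeg]; exact (Finset.mem_filter.1 (hT hv)).2⟩

lemma isK4_of_forall_adj [Finite V] (hC : IsRigidityCircuit C) {T : Finset V} (hT : T.card = 4)
    (h : ∀ u ∈ T, ∀ v ∈ T, u ≠ v → C.Adj u v) : IsK4 C := by
  have hns : ¬ IsSparse (completeOn T) := fun hs => by
    have h1 := hs.ncard_edgeSet_add_three_le (S := T) (by omega) fun u ⟨_, hu⟩ => hu.1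
    rw [ncard_edgeSet_completeOn, hT] at h1
    simp [Nat.choose] at h1
  rw [← hC.eq_of_le hns fun u v huv => h u huv.1 v huv.2.1 huv.2.2]
  exact ⟨T, hT, fun _ _ => Iff.rfl⟩

/-- Circuit elimination in the sparsity matroid. -/
lemma not_isSparse_of_sup_sdiff [Finite V] {A B G : SimpleGraph V} (hA : IsRigidityCircuit A)
    (hB : IsRigidityCircuit B) (hne : A ≠ B) {e : Sym2 V} (heA : e ∈ A.edgeSet)
    (heB : e ∈ B.edgeSet) (hG : G.edgeSet = (A.edgeSet ∪ B.edgeSet) \ {e}) : ¬ IsSparse G := by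
  classical
  intro hs
  obtain ⟨S, hS, hS4, hScard⟩ := hA.exists_support_eq
  obtain ⟨T, hT, hT4, hTcard⟩ := hB.exists_support_eq
  -- Sparsity of the intersection leaves at least 2|S ∪ T|-1 edges in the union, hence one too many
  -- even without e.
  have hinf : IsSparse (A ⊓ B) := hA.isSparse_of_lt <| lt_of_le_of_ne inf_le_left fun h =>
    hne (hB.eq_of_le hA.prop (inf_eq_left.1 h))
  have hST : 2 ≤ (S ∩ T).card := by
    induction e with
    | _ x y =>
      refine Finset.one_lt_card.2 ⟨x, ?_, y, ?_, A.ne_of_adj heA⟩ <;>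
      rw [← Finset.mem_coe, Finset.coe_inter, ← hS, ← hT]
      · exact ⟨⟨y, heA⟩, ⟨y, heB⟩⟩
      · exact ⟨⟨x, heA.symm⟩, ⟨x, heB.symm⟩⟩
  have h1 := hinf.ncard_edgeSet_add_three_le hST (by
    rw [Finset.coe_inter, ← hS, ← hT]
    exact Set.subset_inter (support_mono inf_le_left) (support_mono inf_le_right))
  have hGle : G ≤ A ⊔ B := by
    rw [← edgeSet_subset_edgeSet, hG, edgeSet_sup]
    exact Set.sdiff_subset
  have h2 := hs.ncard_edgeSet_add_three_le (S := S ∪ T)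
    (hST.trans (Finset.card_le_card Finset.inter_subset_union))
    ((support_mono hGle).trans (by
      rw [Finset.coe_union, ← hS, ← hT]
      rintro u ⟨v, h | h⟩
      · exact Or.inl ⟨v, h⟩
      · exact Or.inr ⟨v, h⟩))
  have h3 := Set.ncard_union_add_ncard_inter A.edgeSet B.edgeSet (Set.toFinite _) (Set.toFinite _)
  have h4 := Set.ncard_sdiff_singleton_add_one (Set.mem_union_left B.edgeSet heA) (Set.toFinite _)
  have h5 := Finset.card_union_add_card_inter S T
  rw [edgeSet_inf] at h1
  rw [hG] at h2
  omega

/-! ### Splitting a circuit at vertices of degree three -/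

lemma mem_support_of_ncard_neighborSet_pos {G : SimpleGraph V} {v : V}
    (h : 0 < (G.neighborSet v).ncard) : v ∈ G.support :=
  Set.nonempty_of_ncard_ne_zero h.ne'

/-- Deleting a vertex of degree three from a circuit and adding a new edge on the remaining
vertices creates a circuit through the new edge. -/
lemma exists_circuit_of_degree_three [Finite V] (hC : IsRigidityCircuit C) {c x y : V}
    (hc : (C.neighborSet c).ncard = 3) (hx : x ∈ C.support) (hy : y ∈ C.support) (hxc : x ≠ c)
    (hyc : y ≠ c) (hxy : x ≠ y) (hadj : ¬ C.Adj x y) :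
    ∃ A, IsRigidityCircuit A ∧ A ≤ C.deleteIncidenceSet c ⊔ edge x y ∧ s(x, y) ∈ A.edgeSet ∧
      A.support ⊆ C.support \ {c} := by
  classical
  obtain ⟨S, hS, hS4, hcard⟩ := hC.exists_support_eq
  have hcS : c ∈ C.support := mem_support_of_ncard_neighborSet_pos (by omega)
  have hsupp : (C.deleteIncidenceSet c ⊔ edge x y).support ⊆ C.support \ {c} := by
    rintro u ⟨v, huv | huv⟩
    · have h := deleteIncidenceSet_adj.1 huv
      exact ⟨⟨v, h.1⟩, h.2.1⟩
    · rcases ((edge_adj _ _ _ _).1 huv).1 with ⟨rfl, rfl⟩ | ⟨rfl, rfl⟩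
      · exact ⟨hx, hxc⟩
      · exact ⟨hy, hyc⟩
  -- It has 2n-2-3+1 = 2(n-1)-2 edges on n-1 vertices.
  have hns : ¬ IsSparse (C.deleteIncidenceSet c ⊔ edge x y) := fun hs => by
    have h1 := Finset.card_erase_of_mem (show c ∈ S by rwa [← Finset.mem_coe, ← hS])
    have h2 := hs.ncard_edgeSet_add_three_le (S := S.erase c) (by omega)
      (by rwa [Finset.coe_erase, ← hS])
    have h3 := ncard_edgeSet_deleteIncidenceSet C c
    rw [edgeSet_sup, edgeSet_edge_of_ne hxy, Set.union_singleton, Set.ncard_insert_of_notMem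
      (show s(x, y) ∉ (C.deleteIncidenceSet c).edgeSet from
        fun h => hadj (deleteIncidenceSet_le C c h)) (Set.toFinite _)] at h2
    omega
  obtain ⟨A, hA, hAC⟩ := exists_isRigidityCircuit_le hns
  refine ⟨A, hAC, hA, ?_, (support_mono hA).trans hsupp⟩
  by_contra he
  refine hAC.prop (hC.isSparse_of_lt (lt_of_le_of_lt (fun u v huv => ?_)
    (deleteIncidenceSet_lt C hcS)))
  rcases hA huv with h | h
  · exact h
  · refine absurd ?_ he
    rcases ((edge_adj _ _ _ _).1 h).1 with ⟨rfl, rfl⟩ | ⟨rfl, rfl⟩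
    · exact huv
    · exact huv.symm

/-- As a, b are nonadjacent, exactly six edges disappear, leaving 2(n-2)-4 on n-2 vertices: one
below tight. -/
lemma exists_pair_of_not_adj [Finite V] (hC : IsRigidityCircuit C) {a b : V}
    (ha : (C.neighborSet a).ncard = 3) (hb : (C.neighborSet b).ncard = 3) (hab : a ≠ b)
    (hadj : ¬ C.Adj a b) :
    ∃ x ∈ C.support \ {a, b}, ∃ y ∈ C.support \ {a, b}, x ≠ y ∧ ¬ C.Adj x y ∧
      IsSparse ((C.deleteIncidenceSet a).deleteIncidenceSet b ⊔ edge x y) := by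
  classical
  obtain ⟨S, hS, hS4, hcard⟩ := hC.exists_support_eq
  have hmem : ∀ c, (C.neighborSet c).ncard = 3 → c ∈ C.support := fun c hc =>
    mem_support_of_ncard_neighborSet_pos (by omega)
  have haS : a ∈ S := by rw [← Finset.mem_coe, ← hS]; exact hmem a ha
  have hbS : b ∈ S.erase a := by
    rw [Finset.mem_erase, ← Finset.mem_coe, ← hS]
    exact ⟨hab.symm, hmem b hb⟩
  have hL : IsSparse ((C.deleteIncidenceSet a).deleteIncidenceSet b) :=
    (hC.isSparse_of_lt (deleteIncidenceSet_lt C (hmem a ha))).mono (deleteIncidenceSet_le _ b)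
  have hnb : (C.deleteIncidenceSet a).neighborSet b = C.neighborSet b := by
    ext v
    simp only [mem_neighborSet, deleteIncidenceSet_adj]
    exact ⟨fun h => h.1, fun h => ⟨h, hab.symm, by rintro rfl; exact hadj h.symm⟩⟩
  have h1 := ncard_edgeSet_deleteIncidenceSet C a
  have h2 := ncard_edgeSet_deleteIncidenceSet (C.deleteIncidenceSet a) b
  rw [hnb] at h2
  have h3 := Finset.card_erase_of_mem haS
  have h4 := Finset.card_erase_of_mem hbS
  obtain ⟨x, hx, y, hy, hxy, hT⟩ := exists_pair_forall_not_isTightSet hL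
    (S := (S.erase a).erase b) (by omega) (by omega)
  have hS' : ∀ u, u ∈ (S.erase a).erase b ↔ u ∈ C.support \ {a, b} := fun u => by
    rw [hS]
    simp only [Finset.mem_erase, Set.mem_sdiff, Finset.mem_coe, Set.mem_insert_iff,
      Set.mem_singleton_iff]
    tauto
  refine ⟨x, (hS' x).1 hx, y, (hS' y).1 hy, hxy, fun h => ?_, isSparse_sup_edge hL hT⟩
  -- A pair spanning an edge is itself tight: 2 · 2 = 1 + 3.
  refine hT {x, y} (by simp) (by simp) ?_
  have h5 : 0 < (((C.deleteIncidenceSet a).deleteIncidenceSet b).spannedEdges {x, y}).ncard := by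
    rw [Set.ncard_pos (Set.toFinite _)]
    simp only [Finset.mem_erase] at hx hy
    refine ⟨s(x, y), ?_, by simp⟩
    simp only [mem_edgeSet, deleteIncidenceSet_adj]
    tauto
  have h6 := Finset.card_pair hxy
  unfold IsTightSet
  omega

/-- Every circuit other than a `K₄` is a combinatorial resultant of two circuits with fewer
vertices. -/
theorem exists_isCombRes [Finite V] (hC : IsRigidityCircuit C) (hK : ¬ IsK4 C) :
    ∃ A B e, IsRigidityCircuit A ∧ IsRigidityCircuit B ∧ IsCombRes A B e C ∧
      A.support.ncard < C.support.ncard ∧ B.support.ncard < C.support.ncard := by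
  classical
  obtain ⟨T, hT4, hT⟩ := hC.exists_four_degree_three
  obtain ⟨a, haT, b, hbT, hab, hadj⟩ : ∃ a ∈ T, ∃ b ∈ T, a ≠ b ∧ ¬ C.Adj a b := by
    by_contra! h
    exact hK (hC.isK4_of_forall_adj hT4 h)
  have hmem : ∀ c ∈ T, c ∈ C.support := fun c hc =>
    mem_support_of_ncard_neighborSet_pos (by rw [hT c hc]; omega)
  obtain ⟨x, ⟨hxC, hx⟩, y, ⟨hyC, hy⟩, hxy, hnadj, hsp⟩ :=
    hC.exists_pair_of_not_adj (hT a haT) (hT b hbT) hab hadj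
  simp only [Set.mem_insert_iff, Set.mem_singleton_iff, not_or] at hx hy
  obtain ⟨A, hA, hAle, heA, hAs⟩ :=
    hC.exists_circuit_of_degree_three (hT a haT) hxC hyC hx.1 hy.1 hxy hnadj
  obtain ⟨B, hB, hBle, heB, hBs⟩ :=
    hC.exists_circuit_of_degree_three (hT b hbT) hxC hyC hx.2 hy.2 hxy hnadj
  have hne : A ≠ B := by
    rintro rfl
    refine hA.prop (hsp.mono fun u v huv => ?_)
    have h1 := hAle huv
    have h2 := hBle huv
    simp only [sup_adj, deleteIncidenceSet_adj] at h1 h2 ⊢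
    tauto
  have hsub : (A.edgeSet ∪ B.edgeSet) \ {s(x, y)} ⊆ C.edgeSet := by
    rintro e ⟨he | he, hne⟩
    · have := edgeSet_mono hAle he
      rw [edgeSet_sup] at this
      exact this.elim (fun h => edgeSet_mono (deleteIncidenceSet_le C a) h)
        fun h => absurd (edgeSet_edge_subset h) hne
    · have := edgeSet_mono hBle he
      rw [edgeSet_sup] at this
      exact this.elim (fun h => edgeSet_mono (deleteIncidenceSet_le C b) h)
        fun h => absurd (edgeSet_edge_subset h) hne
  have hedges : C.edgeSet = (A.edgeSet ∪ B.edgeSet) \ {s(x, y)} := by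
    have hG : (fromEdgeSet ((A.edgeSet ∪ B.edgeSet) \ {s(x, y)})).edgeSet =
        (A.edgeSet ∪ B.edgeSet) \ {s(x, y)} := by
      rw [edgeSet_fromEdgeSet, sdiff_eq_left, Set.disjoint_left]
      exact fun e he hd => C.not_isDiag_of_mem_edgeSet (hsub he) hd
    rw [← hG, hC.eq_of_le (not_isSparse_of_sup_sdiff hA hB hne heA heB hG)]
    rwa [← edgeSet_subset_edgeSet, hG]
  have hlt : ∀ (D : SimpleGraph V) (c : V), c ∈ T → D.support ⊆ C.support \ {c} →
      D.support.ncard < C.support.ncard := fun D c hc hD =>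
    Set.ncard_lt_ncard (hD.trans_ssubset
      (Set.sdiff_singleton_ssubset.2 (hmem c hc))) (Set.toFinite _)
  refine ⟨A, B, s(x, y), hA, hB, ⟨hne, heA, heB, ?_, hedges⟩, hlt A a haT hAs, hlt B b hbT hBs⟩
  refine Set.Subset.antisymm ?_
    (Set.union_subset (hAs.trans Set.sdiff_subset) (hBs.trans Set.sdiff_subset))
  rintro u ⟨v, huv⟩
  have huv' : s(u, v) ∈ C.edgeSet := huv
  rw [hedges] at huv'
  exact huv'.1.imp (fun h => ⟨v, h⟩) fun h => ⟨v, h⟩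

end IsRigidityCircuit

theorem theorem1 {V : Type*} [Finite V] (C : SimpleGraph V) (hC : IsRigidityCircuit C) :
    ObtainedFromK4 C ∧ ∃ T : GraphTree V, IsResultantTree C T := by
  induction hn : C.support.ncard using Nat.strong_induction_on generalizing C with
  | _ n ih =>
    subst hn
    by_cases hK : IsK4 C
    · refine ⟨.base C hK, .leaf C, rfl, ?_, ?_, trivial, hK⟩
      · rintro (_ | l) G h
        · obtain rfl : G = C := h
          exact hC
        · exact h.elim
      · rintro (_ | l) G h
        · obtain rfl : G = C := h
          exact le_rfl
        · exact h.elim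
    · obtain ⟨A, B, e, hA, hB, hres, hAlt, hBlt⟩ := hC.exists_isCombRes hK
      obtain ⟨hA', L, hL⟩ := ih _ hAlt A hA rfl
      obtain ⟨hB', R, hR⟩ := ih _ hBlt B hB rfl
      refine ⟨.step A B C e hA' hB' hres hC, .node C L R, rfl, ?_, ?_, ?_, hL.leaves_K4,
        hR.leaves_K4⟩
      · rintro (_ | l) G h
        · obtain rfl : G = C := h
          exact hC
        · exact h.elim (hL.nodes_circuit l G) (hR.nodes_circuit l G)
      · rintro (_ | l) G h
        · obtain rfl : G = C := h
          exact le_rfl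
        · rcases h with h | h
          · have := hL.level_bound l G h
            omega
          · have := hR.level_bound l G h
            omega
      · exact ⟨⟨e, by rwa [hL.root_eq, hR.root_eq]⟩, hL.nodes_resultant, hR.nodes_resultant⟩
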